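/- Let $k$ be an algebraically closed field of characteristic $0$, let $R=k\langle x,y\rangle/(xy-yx-y^2)$, and let $n$ be a natural number. For every $n$-dimensional representation $\rho:R\to M_n(k)$ (a homomorphism of unital $k$-algebras), the image algebra $\rho(R)$ satisfies $$\dim_k\rho(R)\le\frac{n(n+2)}{4}\ \text{ if } n \text{ is even},\qquad \dim_k\rho(R)\le\frac{(n+1)^2}{4}\ \text{ if } n\text{ is odd}.$$ This estimate is optimal: for every $n$ there exist $n$-dimensional representations $\rho$ of $R$ for which the Jordan normal form of $Y=\rho(y)$ is a single block of size $n$, and for every such $\rho$ equality holds, i.e. $\dim_k\rho(R)=\frac{n(n+2)}{4}$ if $n$ is even and $\dim_k\rho(R)=\frac{(n+1)^2}{4}$ if $n$ is odd. -/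

import Mathlib

/-- The defining relation `xy - yx = y²` on the free algebra `k⟨x, y⟩`,
where `x` is the generator `0` and `y` is the generator `1`. -/
inductive JordanianRel (k : Type*) [Field k] :
    FreeAlgebra k (Fin 2) → FreeAlgebra k (Fin 2) → Prop
  | rel : JordanianRel k
      (FreeAlgebra.ι k 0 * FreeAlgebra.ι k 1 - FreeAlgebra.ι k 1 * FreeAlgebra.ι k 0)
      (FreeAlgebra.ι k 1 ^ 2)

/-- The Jordanian algebra `R = k⟨x, y⟩ / (xy - yx - y²)`. -/
abbrev JordanianAlgebra (k : Type*) [Field k] : Type _ :=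
  RingQuot (JordanianRel k)

/-- The generator `y` of the Jordanian algebra. -/
noncomputable def JordanianAlgebra.y (k : Type*) [Field k] : JordanianAlgebra k :=
  RingQuot.mkAlgHom k (JordanianRel k) (FreeAlgebra.ι k 1)

/-- The upper triangular `n × n` Jordan block with eigenvalue `c`: the entries are `c` on the
diagonal, `1` on the first superdiagonal, and `0` elsewhere. -/
def jordanBlock {k : Type*} [Field k] (n : ℕ) (c : k) : Matrix (Fin n) (Fin n) k :=
  Matrix.of fun i j => if j = i then c else if (j : ℕ) = (i : ℕ) + 1 then 1 else 0

/-- The Jordan normal form of the `n × n` matrix `Y` is one full block, that is, `Y` is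
conjugate to a single Jordan block of size `n`. -/
def IsFullBlock {k : Type*} [Field k] {n : ℕ} (Y : Matrix (Fin n) (Fin n) k) : Prop :=
  ∃ (c : k) (P : GL (Fin n) k),
    Y = (P : Matrix (Fin n) (Fin n) k) * jordanBlock n c *
      ((P⁻¹ : GL (Fin n) k) : Matrix (Fin n) (Fin n) k)

/-! Upper bound. The relation makes commutation with X act on polynomials in Y as the derivation t²
d/dt, so the minimal polynomial p of Y divides p′t² and Y is nilpotent (`isNilpotent_of_jordanian`).
Generalized eigenspaces of X are therefore Y-stable (`pow_apply_mem_maxGenEigenspace`). On one of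
dimension m, X − μ and Y are simultaneously strictly triangular (`exists_triangular_basis`), and the
algebra is spanned by the monomials YⁱXʲ: few have i + j < d, and the others lie in the small space
of matrices supported d steps off the diagonal. Taking d near m/2 gives ⌊(m+1)²/4⌋, and
superadditivity of this function sums the blocks.

Equality. After conjugation Y is the nilpotent block J. Two solutions X of the relation with Y = J
differ by a matrix commuting with J, that is, by a polynomial in J, so the image contains the
algebra of the explicit model `eulerShift`. There `linearIndependent_descShift` exhibits enough
independent elements. -/

section

open Module Polynomial

/-! ### Arithmetic of the bound. -/

/-- The maximal dimension of the image of an `n`-dimensional representation of the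
Jordanian algebra. -/
def jordanianBound (n : ℕ) : ℕ := (n + 1) ^ 2 / 4

/-- For a, b ≥ 1, the gap (a+b+1)² − (a+1)² − (b+1)² equals 2ab − 1 > 0. A zero summand needs the
floor. -/
lemma jordanianBound_add_le (a b : ℕ) :
    jordanianBound a + jordanianBound b ≤ jordanianBound (a + b) := by
  unfold jordanianBound
  rcases Nat.eq_zero_or_pos a with rfl | ha
  · simp
  rcases Nat.eq_zero_or_pos b with rfl | hb
  · simp
  rw [Nat.le_div_iff_mul_le (by norm_num)]
  have h1 := Nat.div_mul_le_self ((a + 1) ^ 2) 4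
  have h2 := Nat.div_mul_le_self ((b + 1) ^ 2) 4
  nlinarith [Nat.mul_le_mul ha hb]

lemma sum_jordanianBound_le {ι : Type*} (s : Finset ι) (f : ι → ℕ) :
    ∑ i ∈ s, jordanianBound (f i) ≤ jordanianBound (∑ i ∈ s, f i) := by
  classical
  induction s using Finset.induction_on with
  | empty => simp
  | insert a s ha ih =>
    rw [Finset.sum_insert ha, Finset.sum_insert ha]
    exact (Nat.add_le_add_left ih _).trans (jordanianBound_add_le _ _)

lemma cast_jordanianBound_of_even {n : ℕ} (h : Even n) :
    (jordanianBound n : ℚ) = (n : ℚ) * ((n : ℚ) + 2) / 4 := by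
  obtain ⟨m, rfl⟩ := h
  have : jordanianBound (m + m) = m * (m + 1) := by
    unfold jordanianBound
    rw [show (m + m + 1) ^ 2 = 1 + 4 * (m * (m + 1)) by ring,
      Nat.add_mul_div_left _ _ (by norm_num)]
    simp
  rw [this]; push_cast; ring

lemma cast_jordanianBound_of_odd {n : ℕ} (h : Odd n) :
    (jordanianBound n : ℚ) = ((n : ℚ) + 1) ^ 2 / 4 := by
  obtain ⟨m, rfl⟩ := h
  have : jordanianBound (2 * m + 1) = (m + 1) ^ 2 := by
    unfold jordanianBound
    rw [show (2 * m + 1 + 1) ^ 2 = 4 * (m + 1) ^ 2 by ring, Nat.mul_div_cancel_left _ (by norm_num)]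
  rw [this]; push_cast; ring

lemma two_mul_sum_range_tsub (m e : ℕ) :
    2 * ∑ p ∈ Finset.range (m + e), (m - p) = m * (m + 1) := by
  rw [Finset.sum_range_add, Finset.sum_eq_zero (s := Finset.range e) (fun i _ => by omega),
    add_zero]
  induction m with
  | zero => simp
  | succ m ih =>
    rw [Finset.sum_range_succ']
    have : ∀ p ∈ Finset.range m, m + 1 - (p + 1) = m - p := fun p _ => by omega
    rw [Finset.sum_congr rfl this, mul_add, ih]
    simp; ring

/-- The first sum counts monomials of degree below d = ⌈n/2⌉, the second the matrix entries at least
d steps below the diagonal. -/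
lemma sum_range_add_sum_range_eq_jordanianBound (n : ℕ) :
    (∑ s ∈ Finset.range ((n + 1) / 2), (s + 1)) +
      ∑ p ∈ Finset.range n, (n - (p + (n + 1) / 2)) = jordanianBound n := by
  have h1 : ∀ d, 2 * ∑ s ∈ Finset.range d, (s + 1) = d * (d + 1) := by
    intro d
    induction d with
    | zero => simp
    | succ d ih => rw [Finset.sum_range_succ, mul_add, ih]; ring
  have h2 := two_mul_sum_range_tsub (n - (n + 1) / 2) ((n + 1) / 2)
  rw [show n - (n + 1) / 2 + (n + 1) / 2 = n by omega] at h2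
  have h3 : ∀ p, n - (p + (n + 1) / 2) = n - (n + 1) / 2 - p := fun p => by omega
  simp_rw [h3]
  specialize h1 ((n + 1) / 2)
  have h4 : ∀ m, (m + m + 1) ^ 2 / 4 = m * m + m := fun m => by
    rw [show (m + m + 1) ^ 2 = 1 + 4 * (m * m + m) by ring,
      Nat.add_mul_div_left _ _ (by norm_num)]
    simp
  have h5 : ∀ m, (2 * m + 1 + 1) ^ 2 / 4 = m * m + m + m + 1 := fun m => by
    rw [show (2 * m + 1 + 1) ^ 2 = 4 * (m * m + m + m + 1) by ring,
      Nat.mul_div_cancel_left _ (by norm_num)]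
  unfold jordanianBound
  rcases Nat.even_or_odd n with ⟨m, rfl⟩ | ⟨m, rfl⟩
  · rw [show (m + m + 1) / 2 = m by omega] at *
    rw [show m + m - m = m by omega] at *
    rw [h4]; nlinarith
  · rw [show (2 * m + 1 + 1) / 2 = m + 1 by omega] at *
    rw [show 2 * m + 1 - (m + 1) = m by omega] at *
    rw [h5]; nlinarith

lemma sum_range_sub_two_mul_eq_jordanianBound (n : ℕ) :
    ∑ j ∈ Finset.range n, (n - 2 * j) = jordanianBound n := by
  induction n using Nat.twoStepInduction with
  | zero => simp [jordanianBound]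
  | one => simp [jordanianBound]
  | more n ih _ =>
    rw [Finset.sum_range_succ', Finset.sum_range_succ]
    have : ∀ j ∈ Finset.range n, n + 2 - 2 * (j + 1) = n - 2 * j := fun j _ => by omega
    rw [Finset.sum_congr rfl this, ih]
    unfold jordanianBound
    rw [show (n + 2 + 1) ^ 2 = (n + 1) ^ 2 + 4 * (n + 2) by ring,
      Nat.add_mul_div_left _ _ (by norm_num)]
    omega

/-! ### Consequences of the relation in an arbitrary algebra. -/

section Relation

variable {k A : Type*} [Field k] [Ring A] [Algebra k A] {X Y : A}

lemma jordanian_mul_pow (h : X * Y - Y * X = Y ^ 2) (i : ℕ) :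
    X * Y ^ i = Y ^ i * X + (i : k) • Y ^ (i + 1) := by
  induction i with
  | zero => simp
  | succ i ih =>
    have h' : X * Y = Y * X + Y ^ 2 := by rw [← h]; abel
    rw [pow_succ, ← mul_assoc, ih, add_mul, mul_assoc, h', mul_add, ← mul_assoc, smul_mul_assoc,
      ← pow_succ, ← pow_succ, ← pow_add]
    push_cast
    rw [add_smul, one_smul, add_assoc, add_comm (Y ^ (i + 2))]

lemma jordanian_mul_aeval (h : X * Y - Y * X = Y ^ 2) (p : k[X]) :
    X * aeval Y p = aeval Y p * X + aeval Y (derivative p * Polynomial.X ^ 2) := by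
  induction p using Polynomial.induction_on' with
  | add p q hp hq =>
    simp only [map_add, mul_add, add_mul, hp, hq]
    abel
  | monomial i a =>
    simp only [derivative_monomial, monomial_mul_X_pow, aeval_monomial, ← Algebra.smul_def,
      mul_smul_comm, smul_mul_assoc, jordanian_mul_pow (k := k) h, smul_add, smul_smul]
    cases i <;> simp

/-- At a nonzero root of p the factor t² has multiplicity 0 and, in characteristic 0, p′ has
multiplicity one less than p; this contradicts p ∣ p′t². Hence p is a power of t. -/
lemma isNilpotent_of_jordanian [IsAlgClosed k] [CharZero k] [FiniteDimensional k A]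
    (h : X * Y - Y * X = Y ^ 2) : IsNilpotent Y := by
  set p := minpoly k Y with hp
  have hint : IsIntegral k Y := Algebra.IsIntegral.isIntegral Y
  have hp0 : p ≠ 0 := minpoly.ne_zero hint
  have hdvd : p ∣ derivative p * Polynomial.X ^ 2 := by
    apply minpoly.dvd
    have := jordanian_mul_aeval (k := k) h p
    simpa [hp, minpoly.aeval] using this.symm
  have hroot : ∀ a ∈ p.roots, a = 0 := by
    intro a ha
    by_contra ha0
    have hr : p.IsRoot a := (mem_roots hp0).1 ha
    have hd0 : derivative p ≠ 0 := by
      intro h0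
      have := Polynomial.derivative_eq_zero.1 h0
      rw [eq_C_of_natDegree_eq_zero this] at hr hp0
      simp at hr
      simp [hr] at hp0
    have hne : derivative p * Polynomial.X ^ 2 ≠ 0 := mul_ne_zero hd0 (pow_ne_zero _ X_ne_zero)
    have := rootMultiplicity_le_rootMultiplicity_of_dvd hne hdvd a
    rw [rootMultiplicity_mul hne, derivative_rootMultiplicity_of_root hr,
      rootMultiplicity_eq_zero (p := Polynomial.X ^ 2) (by simpa using ha0)] at this
    have := (rootMultiplicity_pos hp0).2 hr
    omega
  have hs := (IsAlgClosed.splits p).eq_prod_roots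
  rw [Multiset.eq_replicate_card.2 hroot, (minpoly.monic hint).leadingCoeff] at hs
  refine ⟨Multiset.card p.roots, ?_⟩
  have := minpoly.aeval k Y
  rw [← hp, hs] at this
  simpa using this

/-- Ordered monomials span. -/
lemma adjoin_le_span_monomials (h : X * Y - Y * X = Y ^ 2) :
    Subalgebra.toSubmodule (Algebra.adjoin k {X, Y}) ≤
      Submodule.span k (Set.range fun ij : ℕ × ℕ => Y ^ ij.1 * X ^ ij.2) := by
  set M := Submodule.span k (Set.range fun ij : ℕ × ℕ => Y ^ ij.1 * X ^ ij.2) with hM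
  have hmem : ∀ i j, Y ^ i * X ^ j ∈ M := fun i j => Submodule.subset_span ⟨(i, j), rfl⟩
  have hX : ∀ m ∈ M, X * m ∈ M := by
    intro m hm
    induction hm using Submodule.span_induction with
    | mem _ hx =>
      obtain ⟨⟨i, j⟩, rfl⟩ := hx
      have : X * (Y ^ i * X ^ j) = Y ^ i * X ^ (j + 1) + (i : k) • (Y ^ (i + 1) * X ^ j) := by
        rw [← mul_assoc, jordanian_mul_pow (k := k) h, add_mul, mul_assoc, ← pow_succ',
          smul_mul_assoc]
      simp only [this]
      exact M.add_mem (hmem _ _) (M.smul_mem _ (hmem _ _))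
    | zero => simp
    | add x y _ _ hx hy => rw [mul_add]; exact M.add_mem hx hy
    | smul a x _ hx => rw [mul_smul_comm]; exact M.smul_mem _ hx
  have hY : ∀ m ∈ M, Y * m ∈ M := by
    intro m hm
    induction hm using Submodule.span_induction with
    | mem _ hx =>
      obtain ⟨⟨i, j⟩, rfl⟩ := hx
      simp only [← mul_assoc, ← pow_succ']
      exact hmem _ _
    | zero => simp
    | add x y _ _ hx hy => rw [mul_add]; exact M.add_mem hx hy
    | smul a x _ hx => rw [mul_smul_comm]; exact M.smul_mem _ hx
  -- Stability under left multiplication by the whole algebra suffices, since 1 ∈ M.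
  have key : ∀ a ∈ Algebra.adjoin k {X, Y}, ∀ m ∈ M, a * m ∈ M := by
    intro a ha
    induction ha using Algebra.adjoin_induction with
    | mem x hx =>
      rcases hx with rfl | rfl
      exacts [hX, hY]
    | algebraMap r => intro m hm; rw [← Algebra.smul_def]; exact M.smul_mem _ hm
    | add x y _ _ hx hy => intro m hm; rw [add_mul]; exact M.add_mem (hx m hm) (hy m hm)
    | mul x y _ _ hx hy => intro m hm; rw [mul_assoc]; exact hx _ (hy m hm)
  intro a ha
  simpa using key a ha 1 (by simpa using hmem 0 0)

end Relation

/-! ### Nilpotent X and Y: simultaneous triangular form. -/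

section Triangular

variable {k : Type*} [Field k]

/-- The `n × n` matrices whose entries `(q, p)` vanish unless `p + d ≤ q`. -/
def strictLower (k : Type*) [Field k] (n d : ℕ) : Submodule k (Matrix (Fin n) (Fin n) k) where
  carrier := {M | ∀ q p : Fin n, (q : ℕ) < p + d → M q p = 0}
  add_mem' hM hN q p h := by simp [hM q p h, hN q p h]
  zero_mem' := fun _ _ _ => rfl
  smul_mem' c M hM q p h := by simp [hM q p h]

lemma strictLower_mul_mem {n d e : ℕ} {M N : Matrix (Fin n) (Fin n) k}
    (hM : M ∈ strictLower k n d) (hN : N ∈ strictLower k n e) :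
    M * N ∈ strictLower k n (d + e) := by
  intro q p h
  rw [Matrix.mul_apply]
  refine Finset.sum_eq_zero fun r _ => ?_
  by_cases hr : (r : ℕ) < p + e
  · rw [hN r p hr, mul_zero]
  · rw [hM q r (by omega), zero_mul]

lemma strictLower_pow_mem {n : ℕ} {M : Matrix (Fin n) (Fin n) k}
    (hM : M ∈ strictLower k n 1) (d : ℕ) : M ^ d ∈ strictLower k n d := by
  induction d with
  | zero =>
    intro q p h
    rw [pow_zero, Matrix.one_apply_ne]
    rintro rfl
    omega
  | succ d ih => rw [pow_succ]; exact strictLower_mul_mem ih hM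

lemma strictLower_anti {n d e : ℕ} (h : d ≤ e) : strictLower k n e ≤ strictLower k n d :=
  fun _ hM q p hq => hM q p (by omega)

lemma finrank_strictLower_le (n d : ℕ) :
    finrank k (strictLower k n d) ≤ ∑ p ∈ Finset.range n, (n - (p + d)) := by
  classical
  let S := Σ p : Fin n, Fin (n - (p + d))
  let f : strictLower k n d →ₗ[k] (S → k) :=
    { toFun := fun M s => M.1 ⟨s.1 + d + s.2, by have := s.2.2; omega⟩ s.1
      map_add' := fun _ _ => rfl
      map_smul' := fun _ _ => rfl }
  have hf : Function.Injective f := by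
    rw [injective_iff_map_eq_zero]
    rintro ⟨M, hM⟩ h
    ext q p
    by_cases hq : (q : ℕ) < p + d
    · exact hM q p hq
    · have hval : (p : ℕ) + d + (q - (p + d)) = q := by omega
      have hent : M ⟨(p : ℕ) + d + (q - (p + d)), by omega⟩ p = 0 :=
        congrFun h ⟨p, ⟨q - (p + d), by omega⟩⟩
      rwa [show (⟨(p : ℕ) + d + (q - (p + d)), by omega⟩ : Fin n) = q from Fin.ext hval] at hent
  refine (LinearMap.finrank_le_finrank_of_injective hf).trans ?_
  rw [finrank_fintype_fun_eq_card, Fintype.card_sigma]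
  simp [Finset.sum_range]

lemma finrank_span_monomials_le_of_strictLower {n : ℕ} {X Y : Matrix (Fin n) (Fin n) k}
    (hX : X ∈ strictLower k n 1) (hY : Y ∈ strictLower k n 1) :
    finrank k (Submodule.span k (Set.range fun ij : ℕ × ℕ => Y ^ ij.1 * X ^ ij.2)) ≤
      jordanianBound n := by
  classical
  -- This cutoff minimizes d(d+1)/2 + (n−d)(n−d+1)/2.
  set d := (n + 1) / 2 with hd
  let I : Finset (ℕ × ℕ) := (Finset.range d).biUnion fun s => Finset.HasAntidiagonal.antidiagonal s
  let T : Finset (Matrix (Fin n) (Fin n) k) := I.image fun ij => Y ^ ij.1 * X ^ ij.2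
  have hle : Submodule.span k (Set.range fun ij : ℕ × ℕ => Y ^ ij.1 * X ^ ij.2) ≤
      Submodule.span k (T : Set (Matrix (Fin n) (Fin n) k)) ⊔ strictLower k n d := by
    rw [Submodule.span_le]
    rintro _ ⟨⟨i, j⟩, rfl⟩
    by_cases hij : i + j < d
    · refine Submodule.mem_sup_left (Submodule.subset_span ?_)
      refine Finset.mem_coe.2 (Finset.mem_image.2 ⟨(i, j), ?_, rfl⟩)
      simpa [I] using hij
    · exact Submodule.mem_sup_right (strictLower_anti (not_lt.1 hij)
        (strictLower_mul_mem (strictLower_pow_mem hY i) (strictLower_pow_mem hX j)))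
  refine (Submodule.finrank_mono hle).trans ((Submodule.finrank_add_le_finrank_add_finrank _ _).trans ?_)
  rw [← sum_range_add_sum_range_eq_jordanianBound]
  refine add_le_add ?_ (finrank_strictLower_le n d)
  refine (finrank_span_finset_le_card T).trans (Finset.card_image_le.trans
    (Finset.card_biUnion_le.trans ?_))
  simp [hd]

/-- Since XY = Y(X + Y), X preserves the range of Y. If XV + YV = V, iterating gives XᵐV + YV = V
for all m; nilpotency of X then makes Y surjective, contradicting its nilpotency. -/
lemma range_sup_range_lt_top {V : Type*} [AddCommGroup V] [Module k V] [Nontrivial V]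
    {X Y : End k V} (h : X * Y - Y * X = Y ^ 2) (hX : IsNilpotent X) (hY : IsNilpotent Y) :
    LinearMap.range X ⊔ LinearMap.range Y < ⊤ := by
  rw [lt_top_iff_ne_top]
  intro htop
  have hrel : X * Y = Y * (X + Y) := by rw [mul_add, ← pow_two, ← h]; abel
  have key : ∀ m, LinearMap.range (X ^ m) ⊔ LinearMap.range Y = ⊤ := by
    intro m
    induction m with
    | zero => simp [Module.End.one_eq_id]
    | succ m ih =>
      rw [eq_top_iff, ← htop]
      refine sup_le ?_ le_sup_right
      rintro _ ⟨v, rfl⟩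
      have hv : v ∈ LinearMap.range (X ^ m) ⊔ LinearMap.range Y := ih ▸ Submodule.mem_top
      obtain ⟨_, ⟨a, rfl⟩, _, ⟨b, rfl⟩, rfl⟩ := Submodule.mem_sup.1 hv
      rw [map_add]
      refine Submodule.add_mem_sup ⟨a, by rw [pow_succ']; rfl⟩ ⟨(X + Y) b, ?_⟩
      exact (LinearMap.congr_fun hrel b).symm
  obtain ⟨m, hm⟩ := hX
  have hs : LinearMap.range Y = ⊤ := by simpa [hm] using key m
  obtain ⟨l, hl⟩ := hY
  have : Function.Surjective (Y ^ l) := by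
    rw [Module.End.coe_pow]
    exact (LinearMap.range_eq_top.1 hs).iterate l
  obtain ⟨v, hv⟩ := exists_ne (0 : V)
  obtain ⟨w, rfl⟩ := this v
  simp [hl] at hv

lemma isNilpotent_restrict {V : Type*} [AddCommGroup V] [Module k V] {X : End k V}
    (hX : IsNilpotent X) {W : Submodule k V} (hW : ∀ w ∈ W, X w ∈ W) :
    IsNilpotent (X.restrict hW) := by
  obtain ⟨m, hm⟩ := hX
  refine ⟨m, ?_⟩
  rw [Module.End.pow_restrict]
  ext w
  simp [hm]

lemma jordanian_restrict {V : Type*} [AddCommGroup V] [Module k V] {X Y : End k V}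
    (h : X * Y - Y * X = Y ^ 2) {W : Submodule k V} (hX : ∀ w ∈ W, X w ∈ W)
    (hY : ∀ w ∈ W, Y w ∈ W) :
    X.restrict hX * Y.restrict hY - Y.restrict hY * X.restrict hX = Y.restrict hY ^ 2 := by
  ext w
  have := LinearMap.congr_fun h (w : V)
  simpa [pow_two] using this

universe v in
-- A hyperplane containing XV + YV is stable under both maps; a basis obtained for it by induction
-- is extended by a vector y outside it, placed first.
lemma exists_triangular_basis (n : ℕ) : ∀ {V : Type v} [AddCommGroup V] [Module k V]
    [FiniteDimensional k V] (_ : finrank k V = n) {X Y : End k V}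
    (_ : X * Y - Y * X = Y ^ 2) (_ : IsNilpotent X) (_ : IsNilpotent Y),
    ∃ b : Basis (Fin n) k V, ∀ p,
      X (b p) ∈ Submodule.span k (b '' Set.Ioi p) ∧ Y (b p) ∈ Submodule.span k (b '' Set.Ioi p) := by
  induction n with
  | zero =>
    intro V _ _ _ hn X Y _ _ _
    exact ⟨Module.finBasisOfFinrankEq k V hn, fun p => p.elim0⟩
  | succ n ih =>
    intro V _ _ _ hn X Y h hX hY
    have : Nontrivial V := Module.nontrivial_of_finrank_pos (R := k) (by omega)
    obtain ⟨φ, hφ, hle⟩ := Submodule.exists_le_ker_of_lt_top _ (range_sup_range_lt_top h hX hY)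
    set H := LinearMap.ker φ with hH
    have hXH : ∀ w, X w ∈ H := fun w => hle (Submodule.mem_sup_left ⟨w, rfl⟩)
    have hYH : ∀ w, Y w ∈ H := fun w => hle (Submodule.mem_sup_right ⟨w, rfl⟩)
    have hHn : finrank k H = n := by
      have := LinearMap.finrank_range_add_finrank_ker φ
      rw [LinearMap.range_eq_top.2 (LinearMap.surjective hφ), finrank_top, finrank_self] at this
      rw [hH]
      omega
    obtain ⟨b, hb⟩ := ih hHn (jordanian_restrict h (fun w _ => hXH w) (fun w _ => hYH w))
      (isNilpotent_restrict hX _) (isNilpotent_restrict hY _)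
    obtain ⟨y, hy⟩ : ∃ y, φ y ≠ 0 := by
      by_contra! hc
      exact hφ (LinearMap.ext hc)
    let B := Basis.mkFinCons y b
      (fun c x hx hc => by
        have := congrArg φ hc
        simpa [LinearMap.mem_ker.1 hx, hy] using this)
      -- This multiple of y moves z into the hyperplane.
      (fun z => ⟨-(φ z / φ y), by simp [hH, hy]⟩)
    have hB : (B : Fin (n + 1) → V) = Fin.cons y ((↑) ∘ b) := Basis.coe_mkFinCons _ _ _ _
    have hspan : ∀ x ∈ H, x ∈ Submodule.span k (B '' Set.Ioi 0) := by
      intro x hx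
      have h1 : (⟨x, hx⟩ : H) ∈ Submodule.span k (Set.range b) := by rw [b.span_eq]; trivial
      have h2 := Submodule.mem_map_of_mem (f := H.subtype) h1
      rw [Submodule.map_span] at h2
      refine Submodule.span_mono ?_ h2
      rintro _ ⟨_, ⟨i, rfl⟩, rfl⟩
      exact ⟨i.succ, Fin.succ_pos i, by simp [hB]⟩
    have hspan' : ∀ (p : Fin n) (x : H), x ∈ Submodule.span k (b '' Set.Ioi p) →
        (x : V) ∈ Submodule.span k (B '' Set.Ioi p.succ) := by
      intro p x h1
      have h2 := Submodule.mem_map_of_mem (f := H.subtype) h1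
      rw [Submodule.map_span] at h2
      refine Submodule.span_mono ?_ h2
      rintro _ ⟨_, ⟨i, hi, rfl⟩, rfl⟩
      exact ⟨i.succ, Fin.succ_lt_succ_iff.2 hi, by simp [hB]⟩
    refine ⟨B, fun p => ?_⟩
    cases p using Fin.cases with
    | zero => exact ⟨hspan _ (hXH _), hspan _ (hYH _)⟩
    | succ p =>
      have : B p.succ = b p := by simp [hB]
      rw [this]
      exact ⟨hspan' p _ (hb p).1, hspan' p _ (hb p).2⟩

lemma toMatrixAlgEquiv_mem_strictLower {n : ℕ} {V : Type*} [AddCommGroup V] [Module k V]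
    (b : Basis (Fin n) k V) {X : End k V}
    (hX : ∀ p, X (b p) ∈ Submodule.span k (b '' Set.Ioi p)) :
    LinearMap.toMatrixAlgEquiv b X ∈ strictLower k n 1 := by
  intro q p h
  rw [LinearMap.toMatrixAlgEquiv_apply]
  by_contra hne
  have := (b.mem_span_image.1 (hX p)) (Finsupp.mem_support_iff.2 hne)
  have := Fin.lt_def.1 (Set.mem_Ioi.1 this)
  omega

lemma finrank_span_monomials_le_of_isNilpotent {V : Type*} [AddCommGroup V] [Module k V]
    [FiniteDimensional k V] {X Y : End k V} (h : X * Y - Y * X = Y ^ 2)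
    (hX : IsNilpotent X) (hY : IsNilpotent Y) :
    finrank k (Submodule.span k (Set.range fun ij : ℕ × ℕ => Y ^ ij.1 * X ^ ij.2)) ≤
      jordanianBound (finrank k V) := by
  obtain ⟨b, hb⟩ := exists_triangular_basis _ rfl h hX hY
  let e := LinearMap.toMatrixAlgEquiv b
  have := finrank_span_monomials_le_of_strictLower
    (toMatrixAlgEquiv_mem_strictLower b fun p => (hb p).1)
    (toMatrixAlgEquiv_mem_strictLower b fun p => (hb p).2)
  have hcomp : (e.toLinearMap ∘ fun ij : ℕ × ℕ => Y ^ ij.1 * X ^ ij.2) =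
      fun ij : ℕ × ℕ => e Y ^ ij.1 * e X ^ ij.2 := by
    ext1 ij
    simp
  rw [← LinearEquiv.finrank_map_eq e.toLinearEquiv, Submodule.map_span, ← Set.range_comp]
  exact (le_of_eq (congrArg (fun g : ℕ × ℕ → _ => finrank k (Submodule.span k (Set.range g)))
    hcomp)).trans this

end Triangular

/-! ### Gluing over the generalized eigenspaces of X. -/

section UpperBound

variable {k V : Type*} [Field k] [AddCommGroup V] [Module k V] {X Y : End k V}

lemma jordanian_sub_smul_one (h : X * Y - Y * X = Y ^ 2) (μ : k) :
    (X - μ • 1) * Y - Y * (X - μ • 1) = Y ^ 2 := by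
  rw [sub_mul, mul_sub, smul_mul_assoc, mul_smul_comm, one_mul, mul_one, ← h]
  abel

/-- With Z = X − μ, Z Yⁱv = Yⁱ(Zv) + i Yⁱ⁺¹v, and w lies in the eigenspace once Zw does. The outer
induction is on the power of Z killing v, the inner one descends on i from the exponent where Yⁱ =
0. -/
lemma pow_apply_mem_maxGenEigenspace (h : X * Y - Y * X = Y ^ 2) (hY : IsNilpotent Y) {μ : k}
    {v : V} (hv : v ∈ X.maxGenEigenspace μ) (i : ℕ) : (Y ^ i) v ∈ X.maxGenEigenspace μ := by
  have hrel := jordanian_sub_smul_one h μ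
  set Z := X - μ • (1 : End k V) with hZ
  have hback : ∀ w, Z w ∈ X.maxGenEigenspace μ → w ∈ X.maxGenEigenspace μ := by
    intro w hw
    obtain ⟨a, ha⟩ := (X.mem_maxGenEigenspace μ _).1 hw
    exact (X.mem_maxGenEigenspace μ _).2 ⟨a + 1, by rw [pow_succ]; exact ha⟩
  obtain ⟨a, ha⟩ := (X.mem_maxGenEigenspace μ _).1 hv
  rw [← hZ] at ha
  clear hv
  obtain ⟨N, hN⟩ := hY
  induction a generalizing v i with
  | zero =>
    have : v = 0 := by simpa using ha
    simp [this]
  | succ a iha =>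
    have key : ∀ m i, N ≤ i + m → (Y ^ i) v ∈ X.maxGenEigenspace μ := by
      intro m
      induction m with
      | zero => intro i hi; rw [pow_eq_zero_of_le (n := i) (by omega) hN]; exact Submodule.zero_mem _
      | succ m ihm =>
        intro i hi
        apply hback
        have h1 : Z ((Y ^ i) v) = (Y ^ i) (Z v) + (i : k) • (Y ^ (i + 1)) v :=
          LinearMap.congr_fun (jordanian_mul_pow (k := k) hrel i) v
        rw [h1]
        refine Submodule.add_mem _ (iha i ?_) (Submodule.smul_mem _ _ (ihm _ (by omega)))
        rw [pow_succ] at ha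
        exact ha
    exact key N i (by omega)

lemma sub_smul_one_apply_mem_maxGenEigenspace {μ : k} {v : V}
    (hv : v ∈ X.maxGenEigenspace μ) : (X - μ • (1 : End k V)) v ∈ X.maxGenEigenspace μ := by
  obtain ⟨a, ha⟩ := (X.mem_maxGenEigenspace μ _).1 hv
  refine (X.mem_maxGenEigenspace μ _).2 ⟨a, ?_⟩
  have := congrArg (X - μ • (1 : End k V)) ha
  rw [map_zero] at this
  rw [← this, ← Module.End.mul_apply, ← Module.End.mul_apply, ← pow_succ, ← pow_succ']

lemma coe_restrict_pow_apply {W : Submodule k V} (hX : ∀ w ∈ W, X w ∈ W) (i : ℕ) (w : W) :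
    (((X.restrict hX) ^ i) w : V) = (X ^ i) w := by
  induction i with
  | zero => simp
  | succ i ih => rw [pow_succ', pow_succ', Module.End.mul_apply, Module.End.mul_apply, ← ih]; rfl

lemma adjoin_le_adjoin_sub_smul_one (μ : k) :
    Algebra.adjoin k {X, Y} ≤ Algebra.adjoin k {X - μ • (1 : End k V), Y} := by
  refine Algebra.adjoin_le ?_
  rintro W (hW | hW) <;> rw [hW]
  · have h1 := Subalgebra.add_mem _
      (Algebra.subset_adjoin (R := k) (s := ({X - μ • (1 : End k V), Y} : Set (End k V))) (Set.mem_insert _ _))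
      (Subalgebra.smul_mem _ (one_mem _) μ)
    rwa [sub_add_cancel] at h1
  · exact Algebra.subset_adjoin (by simp)

lemma finrank_map_adjoin_le [FiniteDimensional k V] (h : X * Y - Y * X = Y ^ 2)
    (hY : IsNilpotent Y) (μ : k) :
    finrank k ((Subalgebra.toSubmodule (Algebra.adjoin k {X, Y})).map
      (LinearMap.lcomp k V (X.maxGenEigenspace μ).subtype)) ≤
      jordanianBound (finrank k (X.maxGenEigenspace μ)) := by
  set E := X.maxGenEigenspace μ
  have hrel := jordanian_sub_smul_one h μ
  have hXE : ∀ w ∈ E, (X - μ • (1 : End k V)) w ∈ E := fun w hw =>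
    sub_smul_one_apply_mem_maxGenEigenspace hw
  have hYE : ∀ w ∈ E, Y w ∈ E := fun w hw =>
    (pow_one Y) ▸ pow_apply_mem_maxGenEigenspace h hY hw 1
  have hXn : IsNilpotent ((X - μ • (1 : End k V)).restrict hXE) :=
    Module.End.isNilpotent_restrict_maxGenEigenspace_sub_algebraMap X μ _
  have hbound := finrank_span_monomials_le_of_isNilpotent (jordanian_restrict hrel hXE hYE) hXn
    (isNilpotent_restrict hY hYE)
  have hle : (Subalgebra.toSubmodule (Algebra.adjoin k {X, Y})).map
      (LinearMap.lcomp k V E.subtype) ≤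
      (Submodule.span k (Set.range fun ij : ℕ × ℕ =>
        Y.restrict hYE ^ ij.1 * (X - μ • (1 : End k V)).restrict hXE ^ ij.2)).map
        (LinearMap.compRight k E.subtype) := by
    refine (Submodule.map_mono ((Subalgebra.toSubmodule.monotone
      (adjoin_le_adjoin_sub_smul_one μ)).trans (adjoin_le_span_monomials hrel))).trans ?_
    rw [Submodule.map_span, Submodule.map_span, ← Set.range_comp, ← Set.range_comp]
    refine le_of_eq (congrArg (fun g : ℕ × ℕ → _ => Submodule.span k (Set.range g)) ?_)
    ext ⟨i, j⟩ w
    simp [coe_restrict_pow_apply]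
  exact (Submodule.finrank_mono hle).trans ((Submodule.finrank_map_le _ _).trans hbound)

/-- An element of the algebra is determined by its restrictions to the generalized eigenspaces,
whose dimensions are the root multiplicities of the characteristic polynomial and add up to dim V.
-/
theorem finrank_adjoin_le_jordanianBound [IsAlgClosed k] [CharZero k] [FiniteDimensional k V]
    (h : X * Y - Y * X = Y ^ 2) :
    finrank k (Algebra.adjoin k {X, Y}) ≤ jordanianBound (finrank k V) := by
  classical
  have hY : IsNilpotent Y := isNilpotent_of_jordanian (k := k) h
  set A := Subalgebra.toSubmodule (Algebra.adjoin k {X, Y}) with hA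
  set s := X.charpoly.roots.toFinset with hs
  let L := fun μ : s => LinearMap.lcomp k V (X.maxGenEigenspace (μ : k)).subtype
  let f : A →ₗ[k] Π μ : s, A.map (L μ) := LinearMap.pi fun μ => (L μ).submoduleMap A
  have hdim : ∀ μ, finrank k (X.maxGenEigenspace μ) = X.charpoly.roots.count μ := fun μ => by
    rw [LinearMap.finrank_maxGenEigenspace_eq, count_roots]
  have hf : Function.Injective f := by
    rw [injective_iff_map_eq_zero]
    rintro ⟨T, hT⟩ h0
    ext v
    have htop : (⊤ : Submodule k V) ≤ LinearMap.ker T := by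
      rw [← X.iSup_maxGenEigenspace_eq_top]
      refine iSup_le fun μ => ?_
      by_cases hμ : μ ∈ s
      · intro w hw
        have h1 := congrArg Subtype.val (congrFun h0 ⟨μ, hμ⟩)
        exact LinearMap.congr_fun h1 ⟨w, hw⟩
      · have : X.maxGenEigenspace μ = ⊥ := by
          rw [← Submodule.finrank_eq_zero (R := k), hdim]
          exact Multiset.count_eq_zero.2 (by simpa [hs] using hμ)
        rw [this]
        exact bot_le
    exact htop (Submodule.mem_top (x := v))
  calc finrank k A ≤ finrank k (Π μ : s, A.map (L μ)) :=
        LinearMap.finrank_le_finrank_of_injective hf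
    _ = ∑ μ : s, finrank k (A.map (L μ)) := finrank_pi_fintype k
    _ ≤ ∑ μ : s, jordanianBound (finrank k (X.maxGenEigenspace (μ : k))) :=
        Finset.sum_le_sum fun μ _ => finrank_map_adjoin_le h hY _
    _ ≤ jordanianBound (∑ μ : s, finrank k (X.maxGenEigenspace (μ : k))) :=
        sum_jordanianBound_le _ _
    _ = jordanianBound (finrank k V) := by
        congr 1
        simp_rw [hdim]
        rw [Finset.sum_coe_sort s (fun μ => X.charpoly.roots.count μ), hs,
          Multiset.toFinset_sum_count_eq, ← (IsAlgClosed.splits X.charpoly).natDegree_eq_card_roots,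
          LinearMap.charpoly_natDegree]

end UpperBound

/-! ### The explicit model with a full nilpotent block. -/

section ShiftMatrix

variable {k : Type*} [Field k] {n : ℕ}

/-- The matrix with entries `c p` at `(p, p + d)` and zero elsewhere. -/
def shiftMatrix (n d : ℕ) (c : ℕ → k) : Matrix (Fin n) (Fin n) k :=
  Matrix.of fun p q => if (q : ℕ) = p + d then c p else 0

lemma shiftMatrix_apply (d : ℕ) (c : ℕ → k) (p q : Fin n) :
    shiftMatrix n d c p q = if (q : ℕ) = p + d then c p else 0 := rfl

lemma shiftMatrix_mul (d e : ℕ) (a b : ℕ → k) :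
    shiftMatrix n d a * shiftMatrix n e b = shiftMatrix n (d + e) fun p => a p * b (p + d) := by
  ext p q
  rw [Matrix.mul_apply, shiftMatrix_apply]
  by_cases h : (p : ℕ) + d < n
  · rw [Finset.sum_eq_single ⟨p + d, h⟩]
    · simp [shiftMatrix_apply, add_assoc]
    · intro r _ hr
      rw [shiftMatrix_apply, if_neg fun h' => hr (Fin.ext h'), zero_mul]
    · simp
  · rw [Finset.sum_eq_zero, if_neg (by omega)]
    intro r _
    rw [shiftMatrix_apply, if_neg (by omega), zero_mul]

lemma jordanBlock_zero_eq : jordanBlock n (0 : k) = shiftMatrix n 1 fun _ => 1 := by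
  ext p q
  by_cases h : q = p
  · simp [jordanBlock, shiftMatrix, h]
  · simp [jordanBlock, shiftMatrix, h]

lemma jordanBlock_eq_smul_one_add (c : k) : jordanBlock n c = c • 1 + jordanBlock n 0 := by
  ext p q
  by_cases h : q = p
  · simp [jordanBlock, h]
  · simp [jordanBlock, h, Ne.symm h]

lemma jordanBlock_zero_pow (d : ℕ) :
    jordanBlock n (0 : k) ^ d = shiftMatrix n d fun _ => 1 := by
  induction d with
  | zero =>
    ext p q
    simp [shiftMatrix_apply, Matrix.one_apply, Fin.ext_iff, eq_comm]
  | succ d ih => rw [pow_succ, ih, jordanBlock_zero_eq, shiftMatrix_mul]; simp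

lemma isNilpotent_jordanBlock_zero : IsNilpotent (jordanBlock n (0 : k)) := by
  refine ⟨n, ?_⟩
  ext p q
  rw [jordanBlock_zero_pow, shiftMatrix_apply, if_neg (by omega)]
  rfl

/-- The scalar matrix c is a difference of two commuting nilpotents. -/
lemma eq_zero_of_isNilpotent_jordanBlock [NeZero n] {c : k}
    (h : IsNilpotent (jordanBlock n c)) : c = 0 := by
  have h1 : IsNilpotent (c • (1 : Matrix (Fin n) (Fin n) k)) := by
    have h2 : c • (1 : Matrix (Fin n) (Fin n) k) = jordanBlock n c - jordanBlock n 0 := by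
      rw [jordanBlock_eq_smul_one_add]; abel
    rw [h2]
    refine Commute.isNilpotent_sub ?_ h isNilpotent_jordanBlock_zero
    rw [jordanBlock_eq_smul_one_add]
    exact ((Commute.one_left _).smul_left c).add_left (Commute.refl _)
  obtain ⟨m, hm⟩ := h1
  have h3 := congrFun (congrFun hm 0) 0
  rw [_root_.smul_pow, one_pow] at h3
  exact IsNilpotent.eq_zero ⟨m, by simpa using h3⟩

/-- In the basis `1, y, …, y^(n-1)` of `k[y]/(y^n)`, this is the transpose of multiplication by
`y` composed with the Euler operator, up to sign. -/
def eulerShift (k : Type*) [Field k] (n : ℕ) : Matrix (Fin n) (Fin n) k :=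
  shiftMatrix n 1 fun p => -(p : k)

lemma eulerShift_jordanian :
    eulerShift k n * jordanBlock n 0 - jordanBlock n 0 * eulerShift k n = jordanBlock n 0 ^ 2 := by
  rw [jordanBlock_zero_pow, jordanBlock_zero_eq, eulerShift, shiftMatrix_mul, shiftMatrix_mul]
  ext p q
  simp only [Matrix.sub_apply, shiftMatrix_apply]
  split_ifs <;> simp

lemma eulerShift_add_smul (a : k) :
    eulerShift k n + a • jordanBlock n 0 = shiftMatrix n 1 fun p => a - p := by
  rw [jordanBlock_zero_eq, eulerShift]
  ext p q
  simp only [Matrix.add_apply, Matrix.smul_apply, shiftMatrix_apply]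
  split_ifs <;> simp
  ring

/-- Elements of the algebra generated by `eulerShift k n` and `jordanBlock n 0` that are
triangular with respect to their first nonzero entries. -/
def descShift (k : Type*) [Field k] (n i j : ℕ) : Matrix (Fin n) (Fin n) k :=
  shiftMatrix n (i + j) fun p => ∏ t ∈ Finset.range j, ((t : k) - p)

lemma descShift_mem_adjoin (i j : ℕ) :
    descShift k n i j ∈ Algebra.adjoin k {eulerShift k n, jordanBlock n (0 : k)} := by
  set A := Algebra.adjoin k {eulerShift k n, jordanBlock n (0 : k)}
  have hX : eulerShift k n ∈ A := Algebra.subset_adjoin (by simp)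
  have hY : jordanBlock n (0 : k) ∈ A := Algebra.subset_adjoin (by simp)
  induction j with
  | zero =>
    have : descShift k n i 0 = jordanBlock n 0 ^ i := by
      rw [jordanBlock_zero_pow]; simp [descShift]
    exact this ▸ pow_mem hY i
  | succ j ih =>
    -- The scalar i + 2j is chosen so that the new factor at row p + i + j is (i + 2j) − (p + i + j)
    -- = j − p.
    have : descShift k n i (j + 1) =
        descShift k n i j * (eulerShift k n + ((i : k) + 2 * j) • jordanBlock n 0) := by
      rw [eulerShift_add_smul, descShift, descShift, shiftMatrix_mul]
      congr 1
      ext p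
      rw [Finset.prod_range_succ]
      push_cast
      ring
    rw [this]
    exact mul_mem ih (add_mem hX (Subalgebra.smul_mem _ hY _))

lemma linearIndependent_descShift [CharZero k] :
    LinearIndependent k fun s : Σ j : Fin n, Fin (n - 2 * j) => descShift k n s.2 s.1 := by
  rw [Fintype.linearIndependent_iff]
  intro g hg
  suffices H : ∀ m : ℕ, ∀ s : Σ j : Fin n, Fin (n - 2 * j), (s.1 : ℕ) = m → g s = 0 from
    fun s => H _ s rfl
  intro m
  induction m using Nat.strong_induction_on with
  | _ m ih =>
    rintro ⟨j, i⟩ rfl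
    have hi := i.2
    -- In row j the product ∏_{t<j'} (t − j) vanishes exactly when j' > j; smaller j' are handled by
    -- induction, and for j' = j the column singles out i. The column exists because i < n − 2j.
    have hentry := congrFun (congrFun hg j) ⟨i + 2 * j, by omega⟩
    rw [Matrix.sum_apply, Finset.sum_eq_single ⟨j, i⟩] at hentry
    · simp only [Matrix.smul_apply, descShift, shiftMatrix_apply] at hentry
      rw [if_pos (by ring)] at hentry
      refine (smul_eq_zero.1 hentry).resolve_right (Finset.prod_ne_zero_iff.2 fun t ht => ?_)
      rw [sub_ne_zero]
      exact_mod_cast (Finset.mem_range.1 ht).ne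
    · rintro ⟨j', i'⟩ _ hne
      rcases lt_trichotomy (j' : ℕ) j with hlt | heq | hgt
      · rw [ih _ hlt ⟨j', i'⟩ rfl]; simp
      · obtain rfl := Fin.ext heq
        have : (i' : ℕ) ≠ i := fun h => hne (by rw [Fin.ext h])
        simp only [Matrix.smul_apply, descShift, shiftMatrix_apply]
        rw [if_neg (by omega), smul_zero]
      · simp only [Matrix.smul_apply, descShift, shiftMatrix_apply]
        rw [Finset.prod_eq_zero (Finset.mem_range.2 hgt) (sub_self _)]
        simp
    · simp

lemma jordanianBound_le_finrank_adjoin [CharZero k] :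
    jordanianBound n ≤
      finrank k (Algebra.adjoin k {eulerShift k n, jordanBlock n (0 : k)}) := by
  set A := Algebra.adjoin k {eulerShift k n, jordanBlock n (0 : k)}
  let v : (Σ j : Fin n, Fin (n - 2 * j)) → A := fun s => ⟨_, descShift_mem_adjoin s.2 s.1⟩
  have hv : LinearIndependent k v :=
    LinearIndependent.of_comp A.val.toLinearMap linearIndependent_descShift
  have := hv.fintype_card_le_finrank
  rw [Fintype.card_sigma] at this
  simp only [Fintype.card_fin] at this
  rwa [Fin.sum_univ_eq_sum_range (fun j => n - 2 * j) n, sum_range_sub_two_mul_eq_jordanianBound]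
    at this

/-- Row p + 1 of N is row p of JN = NJ, so it vanishes once row p of N does. -/
lemma eq_zero_of_commute_jordanBlock [NeZero n] {N : Matrix (Fin n) (Fin n) k}
    (h : N * jordanBlock n 0 = jordanBlock n 0 * N) (h0 : ∀ q, N 0 q = 0) : N = 0 := by
  have hrow : ∀ p : ℕ, ∀ p' : Fin n, (p' : ℕ) = p → ∀ q, N p' q = 0 := by
    intro p
    induction p with
    | zero =>
      intro p' hp q
      rw [show p' = 0 from Fin.ext hp]
      exact h0 q
    | succ p ih =>
      intro p' hp q
      have h1 := congrFun (congrFun h ⟨p, by omega⟩) q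
      have hL : (N * jordanBlock n 0 : Matrix (Fin n) (Fin n) k) ⟨p, by omega⟩ q = 0 := by
        rw [Matrix.mul_apply]
        exact Finset.sum_eq_zero fun r _ => by rw [ih ⟨p, by omega⟩ rfl, zero_mul]
      have hR : (jordanBlock n 0 * N : Matrix (Fin n) (Fin n) k) ⟨p, by omega⟩ q = N p' q := by
        rw [Matrix.mul_apply, jordanBlock_zero_eq, Finset.sum_eq_single p']
        · rw [shiftMatrix_apply, if_pos hp, one_mul]
        · intro r _ hr
          rw [shiftMatrix_apply, if_neg, zero_mul]
          exact fun h' => hr (Fin.ext (h'.trans hp.symm))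
        · simp
      rw [← hR, ← h1, hL]
  ext p q
  exact hrow p p rfl q

/-- A matrix commuting with the nilpotent Jordan block is a polynomial in it. -/
lemma mem_adjoin_of_commute_jordanBlock {M : Matrix (Fin n) (Fin n) k}
    (h : Commute M (jordanBlock n 0)) : M ∈ Algebra.adjoin k {jordanBlock n (0 : k)} := by
  rcases Nat.eq_zero_or_pos n with rfl | hn
  · rw [Subsingleton.elim M 0]; exact zero_mem _
  have : NeZero n := ⟨hn.ne'⟩
  -- The polynomial in J having the same first row as M.
  let Q : Matrix (Fin n) (Fin n) k := ∑ d : Fin n, M 0 d • jordanBlock n (0 : k) ^ (d : ℕ)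
  have hJ := Algebra.subset_adjoin (R := k) (Set.mem_singleton (jordanBlock n (0 : k)))
  have hQ : Q ∈ Algebra.adjoin k {jordanBlock n (0 : k)} :=
    sum_mem fun d _ => Subalgebra.smul_mem _ (pow_mem hJ _) _
  have hQc : Commute Q (jordanBlock n 0) := by
    refine Commute.sum_left _ _ _ fun d _ => Commute.smul_left ?_ _
    exact (Commute.refl (jordanBlock n (0 : k))).pow_left _
  have hMQ : M - Q = 0 := by
    refine eq_zero_of_commute_jordanBlock (h.sub_left hQc).eq fun q => ?_
    have hQq : Q 0 q = ∑ d : Fin n, (M 0 d • jordanBlock n (0 : k) ^ (d : ℕ)) 0 q :=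
      Matrix.sum_apply _ _ _ _
    rw [Matrix.sub_apply, sub_eq_zero, hQq, Finset.sum_eq_single q]
    · rw [jordanBlock_zero_pow, Matrix.smul_apply, shiftMatrix_apply, if_pos (by simp)]
      simp
    · intro d _ hd
      rw [jordanBlock_zero_pow, Matrix.smul_apply, shiftMatrix_apply, if_neg, smul_zero]
      simpa [Fin.ext_iff, eq_comm] using hd
    · simp
  rwa [sub_eq_zero.1 hMQ]

end ShiftMatrix

/-! ### Transfer to representations of the Jordanian algebra. -/

section Representation

variable {k : Type*} [Field k] {A : Type*} [Ring A] [Algebra k A]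

/-- The generator `x` of the Jordanian algebra. -/
noncomputable def JordanianAlgebra.x (k : Type*) [Field k] : JordanianAlgebra k :=
  RingQuot.mkAlgHom k (JordanianRel k) (FreeAlgebra.ι k 0)

lemma JordanianAlgebra.x_mul_y_sub :
    JordanianAlgebra.x k * JordanianAlgebra.y k - JordanianAlgebra.y k * JordanianAlgebra.x k =
      JordanianAlgebra.y k ^ 2 := by
  have := RingQuot.mkAlgHom_rel k (JordanianRel.rel (k := k))
  simpa [JordanianAlgebra.x, JordanianAlgebra.y] using this

lemma JordanianAlgebra.map_relation (ρ : JordanianAlgebra k →ₐ[k] A) :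
    ρ (x k) * ρ (y k) - ρ (y k) * ρ (x k) = ρ (y k) ^ 2 := by
  rw [← map_mul, ← map_mul, ← map_sub, x_mul_y_sub, map_pow]

lemma JordanianAlgebra.range_eq_adjoin (ρ : JordanianAlgebra k →ₐ[k] A) :
    ρ.range = Algebra.adjoin k {ρ (x k), ρ (y k)} := by
  have h1 : ρ.range = (ρ.comp (RingQuot.mkAlgHom k (JordanianRel k))).range := by
    rw [AlgHom.range_comp, (AlgHom.range_eq_top _).2 (RingQuot.mkAlgHom_surjective k _),
      Algebra.map_top]
  rw [h1, ← Algebra.map_top, ← FreeAlgebra.adjoin_range_ι, AlgHom.map_adjoin, ← Set.range_comp]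
  congr 1
  ext a
  simp [Fin.exists_fin_two, x, y, eq_comm]

lemma JordanianAlgebra.exists_algHom {X Y : A} (h : X * Y - Y * X = Y ^ 2) :
    ∃ ρ : JordanianAlgebra k →ₐ[k] A, ρ (y k) = Y := by
  refine ⟨RingQuot.liftAlgHom k ⟨FreeAlgebra.lift k ![X, Y], ?_⟩, ?_⟩
  · rintro _ _ ⟨⟩
    simpa using h
  · simp [y]

lemma finrank_range_algEquiv_comp {B C : Type*} [Ring B] [Algebra k B] [Ring C] [Algebra k C]
    (e : A ≃ₐ[k] B) (ρ : C →ₐ[k] A) :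
    finrank k ((e : A →ₐ[k] B).comp ρ).range = finrank k ρ.range := by
  rw [AlgHom.range_comp]
  exact (e.subalgebraMap ρ.range).toLinearEquiv.finrank_eq.symm

theorem JordanianAlgebra.finrank_range_le [IsAlgClosed k] [CharZero k] {n : ℕ}
    (ρ : JordanianAlgebra k →ₐ[k] Matrix (Fin n) (Fin n) k) :
    finrank k ρ.range ≤ jordanianBound n := by
  rw [← finrank_range_algEquiv_comp Matrix.toLinAlgEquiv' ρ, range_eq_adjoin]
  refine (finrank_adjoin_le_jordanianBound (map_relation _)).trans (le_of_eq ?_)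
  simp

lemma JordanianAlgebra.le_finrank_range_of_map_y_eq [CharZero k] {n : ℕ}
    (ρ : JordanianAlgebra k →ₐ[k] Matrix (Fin n) (Fin n) k)
    (hρ : ρ (y k) = jordanBlock n 0) : jordanianBound n ≤ finrank k ρ.range := by
  suffices hle : Algebra.adjoin k {eulerShift k n, jordanBlock n (0 : k)} ≤ ρ.range from
    jordanianBound_le_finrank_adjoin.trans
      (Submodule.finrank_mono (Subalgebra.toSubmodule.monotone hle))
  refine Algebra.adjoin_le ?_
  have hY : jordanBlock n 0 ∈ ρ.range := ⟨_, hρ⟩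
  rintro _ (rfl | rfl)
  · have hc : Commute (ρ (x k) - eulerShift k n) (jordanBlock n 0) := by
      have h1 := map_relation ρ
      rw [hρ, ← eulerShift_jordanian] at h1
      -- Both ρ(x) and the model have the same commutator J² with J, so their difference commutes
      -- with J.
      rw [Commute, SemiconjBy, sub_mul, mul_sub, sub_eq_sub_iff_sub_eq_sub]
      exact h1
    have h2 : ρ (x k) - eulerShift k n ∈ ρ.range :=
      Algebra.adjoin_le (Set.singleton_subset_iff.2 hY) (mem_adjoin_of_commute_jordanBlock hc)
    have h3 := sub_mem (⟨_, rfl⟩ : ρ (x k) ∈ ρ.range) h2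
    rwa [sub_sub_cancel] at h3
  · exact hY

theorem JordanianAlgebra.le_finrank_range_of_isFullBlock [IsAlgClosed k] [CharZero k] {n : ℕ}
    (ρ : JordanianAlgebra k →ₐ[k] Matrix (Fin n) (Fin n) k) (h : IsFullBlock (ρ (y k))) :
    jordanianBound n ≤ finrank k ρ.range := by
  obtain ⟨c, P, hP⟩ := h
  let e : Matrix (Fin n) (Fin n) k ≃ₐ[k] Matrix (Fin n) (Fin n) k :=
    MulSemiringAction.toAlgEquiv k _ (ConjAct.toConjAct P⁻¹)
  let ρ' := (e : Matrix (Fin n) (Fin n) k →ₐ[k] Matrix (Fin n) (Fin n) k).comp ρ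
  have he : ρ' (y k) = jordanBlock n c := by
    have : ρ' (y k) =
        ((P⁻¹ : GL (Fin n) k) : Matrix (Fin n) (Fin n) k) * ρ (y k) * (P⁻¹⁻¹ : GL (Fin n) k) := rfl
    rw [this, hP, inv_inv]
    simp only [← mul_assoc, Units.inv_mul, one_mul]
    rw [mul_assoc, Units.inv_mul, mul_one]
  rw [← finrank_range_algEquiv_comp e]
  apply le_finrank_range_of_map_y_eq
  -- For n = 0 the eigenvalue c is arbitrary, but all matrices coincide; otherwise nilpotency forces
  -- c = 0.
  rcases Nat.eq_zero_or_pos n with rfl | hn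
  · exact Subsingleton.elim _ _
  have : NeZero n := ⟨hn.ne'⟩
  have hnil := isNilpotent_of_jordanian (k := k) (map_relation ρ')
  rw [he] at hnil
  exact he.trans (by rw [eq_zero_of_isNilpotent_jordanBlock hnil])

lemma JordanianAlgebra.exists_isFullBlock (k : Type*) [Field k] (n : ℕ) :
    ∃ ρ : JordanianAlgebra k →ₐ[k] Matrix (Fin n) (Fin n) k, IsFullBlock (ρ (y k)) := by
  obtain ⟨ρ, hρ⟩ := exists_algHom (k := k) (eulerShift_jordanian (k := k) (n := n))
  exact ⟨ρ, 0, 1, by simp [hρ]⟩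

end Representation

end

theorem theorem8p1 (k : Type*) [Field k] [IsAlgClosed k] [CharZero k] (n : ℕ) :
    -- the upper bound, for every representation
    (∀ ρ : JordanianAlgebra k →ₐ[k] Matrix (Fin n) (Fin n) k,
      (Even n → (Module.finrank k ρ.range : ℚ) ≤ (n : ℚ) * ((n : ℚ) + 2) / 4) ∧
      (Odd n → (Module.finrank k ρ.range : ℚ) ≤ ((n : ℚ) + 1) ^ 2 / 4)) ∧
    -- representations with full-block `Y` exist
    (∃ ρ : JordanianAlgebra k →ₐ[k] Matrix (Fin n) (Fin n) k,
      IsFullBlock (ρ (JordanianAlgebra.y k))) ∧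
    -- and the bound is attained at each of them
    (∀ ρ : JordanianAlgebra k →ₐ[k] Matrix (Fin n) (Fin n) k,
      IsFullBlock (ρ (JordanianAlgebra.y k)) →
      (Even n → (Module.finrank k ρ.range : ℚ) = (n : ℚ) * ((n : ℚ) + 2) / 4) ∧
      (Odd n → (Module.finrank k ρ.range : ℚ) = ((n : ℚ) + 1) ^ 2 / 4)) := by
  refine ⟨fun ρ => ⟨fun hn => ?_, fun hn => ?_⟩, JordanianAlgebra.exists_isFullBlock k n,
    fun ρ hρ => ⟨fun hn => ?_, fun hn => ?_⟩⟩
  · rw [← cast_jordanianBound_of_even hn]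
    exact_mod_cast JordanianAlgebra.finrank_range_le ρ
  · rw [← cast_jordanianBound_of_odd hn]
    exact_mod_cast JordanianAlgebra.finrank_range_le ρ
  · rw [← cast_jordanianBound_of_even hn]
    exact_mod_cast (JordanianAlgebra.finrank_range_le ρ).antisymm
      (JordanianAlgebra.le_finrank_range_of_isFullBlock ρ hρ)
  · rw [← cast_jordanianBound_of_odd hn]
    exact_mod_cast (JordanianAlgebra.finrank_range_le ρ).antisymm
      (JordanianAlgebra.le_finrank_range_of_isFullBlock ρ hρ)
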